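/- Let $\Omega\subset\mathbb C$ be a bounded domain with $C^{1,\alpha}$ boundary, where $\alpha>0$. For an integer $k\ge 0$ and a real number $\nu>0$, let $C^{k,Log^\nu L}(\Omega)$ denote the space of complex-valued functions $f\in C^k(\Omega)$ such that $$\|f\|_{C^{k,Log^\nu L}(\Omega)}:=\sum_{|\gamma|\le k}\ \sup_{w\in\Omega}|D^\gamma f(w)|+\sum_{|\gamma|=k}\ \sup_{w,\,w+h\in\Omega,\ h\neq 0}|D^\gamma f(w+h)-D^\gamma f(w)|\,\bigl|\ln|h|\bigr|^{\nu}<\infty,$$ where $D^\gamma=\partial_x^{\gamma_1}\partial_y^{\gamma_2}$ for $\gamma=(\gamma_1,\gamma_2)$ and $z=x+iy$. Write $C^{Log^\nu L}(\Omega)=C^{0,Log^\nu L}(\Omega)$. A $(0,1)$-form $\mathbf f=f\,d\bar z$ is said to be in $C^{Log^\nu L}(\Omega)$ if $f$ is, and then $\|\mathbf f\|_{C^{Log^\nu L}(\Omega)}:=\|f\|_{C^{Log^\nu L}(\Omega)}$. Let $\nu>1$. Then there is a constant $C$, depending only on $\Omega$ and $\nu$, such that for every $(0,1)$-form $\mathbf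 f=f\,d\bar z\in C^{Log^\nu L}(\Omega)$ there exists $u\in C^{1,Log^{\nu-1}L}(\Omega)$ with $\bar\partial u=\mathbf f$ on $\Omega$, that is, $\frac{\partial u}{\partial\bar z}=\frac12\left(\frac{\partial u}{\partial x}+i\frac{\partial u}{\partial y}\right)=f$ at every point of $\Omega$, and $$\|u\|_{C^{1,Log^{\nu-1}L}(\Omega)}\le C\,\|\mathbf f\|_{C^{Log^{\nu}L}(\Omega)}.$$ In particular, $u\in C^1(\overline\Omega)$, that is, $u$ and its first-order partial derivatives extend continuously to $\overline\Omega$, and $$\|u\|_{C^1(\overline\Omega)}:=\sum_{|\gamma|\le 1}\ \sup_{\Omega}|D^\gamma u|\le C\,\|\mathbf f\|_{C^{Log^{\nu}L}(\Omega)}.$$ -/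

import Mathlib

open scoped NNReal ENNReal

noncomputable section

namespace LogCont

/-- `Ω ⊆ ℂ` has `C^{1,α}` boundary: near each boundary point `p`, in the rotated coordinates
`x + i y = conj a * (z - p)` with `|a| = 1`, the set `Ω` is the strict epigraph `φ x < y` of a
`C^1` function `φ` of one real variable whose derivative is Hölder continuous of exponent `α`. -/
def HasC1HolderBoundary (α : ℝ≥0) (Ω : Set ℂ) : Prop :=
  ∀ p ∈ frontier Ω, ∃ (a : ℂ) (r : ℝ) (φ : ℝ → ℝ) (K : ℝ≥0), ‖a‖ = 1 ∧ 0 < r ∧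
    ContDiffOn ℝ 1 φ (Set.Ioo (-r) r) ∧
    HolderOnWith K α (deriv φ) (Set.Ioo (-r) r) ∧
    ∀ z ∈ Metric.ball p r,
      z ∈ Ω ↔ φ (starRingEnd ℂ a * (z - p)).re < (starRingEnd ℂ a * (z - p)).im

/-- A bounded domain (nonempty, open, connected, bounded set) with `C^{1,α}` boundary. -/
structure IsBoundedC1HolderDomain (α : ℝ≥0) (Ω : Set ℂ) : Prop where
  isOpen : IsOpen Ω
  isConnected : IsConnected Ω
  isBounded : Bornology.IsBounded Ω
  boundary : HasC1HolderBoundary α Ω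

/-- The partial derivative `∂f/∂x`, where `z = x + i y`. -/
def dx (f : ℂ → ℂ) (z : ℂ) : ℂ := fderiv ℝ f z 1

/-- The partial derivative `∂f/∂y`, where `z = x + i y`. -/
def dy (f : ℂ → ℂ) (z : ℂ) : ℂ := fderiv ℝ f z Complex.I

/-- The derivative `D^γ f = ∂_x^{γ₁} ∂_y^{γ₂} f` for a multi-index `γ = (γ₁, γ₂)`. -/
def D (γ : ℕ × ℕ) (f : ℂ → ℂ) : ℂ → ℂ := dx^[γ.1] (dy^[γ.2] f)

/-- The norm of `C^k(closure Ω)`: the sum over `|γ| ≤ k` of the suprema of `|D^γ f|`.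
The supremum over `Ω` equals that over the closure for the continuous extension. -/
def cNorm (k : ℕ) (Ω : Set ℂ) (f : ℂ → ℂ) : ℝ≥0∞ :=
  ∑ j ∈ Finset.range (k + 1), ∑ γ ∈ Finset.HasAntidiagonal.antidiagonal j, ⨆ w ∈ Ω, ‖D γ f w‖ₑ

/-- The seminorm
`∑_{|γ| = k} sup_{w, w + h ∈ Ω} |D^γ f (w + h) - D^γ f w| |ln |h||^ν`. -/
def logSeminorm (k : ℕ) (ν : ℝ) (Ω : Set ℂ) (f : ℂ → ℂ) : ℝ≥0∞ :=
  ∑ γ ∈ Finset.HasAntidiagonal.antidiagonal k, ⨆ (w : ℂ) (h : ℂ) (_ : w ∈ Ω) (_ : w + h ∈ Ω),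
    ‖D γ f (w + h) - D γ f w‖ₑ * ENNReal.ofReal (|Real.log ‖h‖| ^ ν)

/-- The norm of `C^{k, Log^ν L}(Ω)`, with value `∞` allowed. -/
def logNorm (k : ℕ) (ν : ℝ) (Ω : Set ℂ) (f : ℂ → ℂ) : ℝ≥0∞ :=
  cNorm k Ω f + logSeminorm k ν Ω f

/-- The function `f` belongs to `C^{k, Log^ν L}(Ω)`. -/
def MemLog (k : ℕ) (ν : ℝ) (Ω : Set ℂ) (f : ℂ → ℂ) : Prop :=
  ContDiffOn ℝ k f Ω ∧ logNorm k ν Ω f < ∞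

/-- The function `f` belongs to `C^k(closure Ω)`: it is `C^k` on `Ω`, and all its partial
derivatives of order at most `k` extend continuously to the closure of `Ω`. -/
def MemCClosure (k : ℕ) (Ω : Set ℂ) (f : ℂ → ℂ) : Prop :=
  ContDiffOn ℝ k f Ω ∧ ∀ γ : ℕ × ℕ, γ.1 + γ.2 ≤ k →
    ∃ g : ℂ → ℂ, ContinuousOn g (closure Ω) ∧ Set.EqOn g (D γ f) Ω

/-- The differential form `dz̄`, as a real-linear form with values in `ℂ`. -/
def dzbar : ℂ →L[ℝ] ℂ := (Complex.conjCLE : ℂ →L[ℝ] ℂ)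

/-- The `(0,1)`-form `∂̄u = (∂u/∂z̄) dz̄`, where `∂u/∂z̄ = (∂u/∂x + i ∂u/∂y) / 2`. -/
def dbar (u : ℂ → ℂ) (z : ℂ) : ℂ →L[ℝ] ℂ :=
  ((dx u z + Complex.I * dy u z) / 2) • dzbar

end LogCont

end

/-!
The regularity of the boundary plays no role: the data are extended to the whole plane first, and
the equation is solved there.

The modulus `|ln t|^(-ν)`, made constant for `t ≥ e^(-ν)`, is nondecreasing and subadditive
(`logModulus_add_le`), because its quotient by `t` is nonincreasing. McShane's formula therefore
extends the coefficient `f`, put equal to zero outside a large disc, to a compactly supported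
function `F` on `ℂ` with the same modulus up to a constant (`exists_extension_of_memLog`).

The solution is the Cauchy transform of `F`, with the Cauchy kernel cut into dyadic pieces
`ε⁻¹ k(z / ε)`, `ε = 2R · 2⁻ʲ`, where `k` is smooth and supported in an annulus. No singular
integral is needed. As `∇k` has mean zero, the gradient of the piece at scale `ε` is bounded by the
oscillation of `F` at scale `ε`, that is by a multiple of `(j + 1)^(-ν)`, and its Lipschitz constant
by `ε⁻¹` times this (`exists_bound_integral_smul_fderiv`). Since `ν > 1` the gradients can be
summed. Comparing the two bounds at distance `d`, the scales coarser than `d` contribute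
`|ln d|^(-ν)` and the finer ones the tail `∑_{j ≥ |ln d|} j^(-ν) ≈ |ln d|^(1-ν)`, which is the
loss of one power of the logarithm (`exists_sum_min_le`).

The `∂/∂z̄`-derivative of `k` is a difference of two dilates of one radial bump
(`dbar_annularKernel`), so that the `∂/∂z̄`-derivatives of the pieces telescope: their sum is the
limit of the averages of `F` at scale tending to zero, a multiple of `F`, minus the average at the
largest scale, which vanishes near the origin because `F` has compact support.
-/

namespace LogCont

/-! ### The logarithmic modulus of continuity -/

/-- The modulus of continuity `t ↦ |ln t|^(-ν)`, made constant for `t ≥ e^(-ν)`. The cut at `e^(-ν)`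
is what makes the function subadditive on `[0, ∞)`. -/
noncomputable def logModulus (ν t : ℝ) : ℝ := if t ≤ 0 then 0 else (max ν (-Real.log t)) ^ (-ν)

lemma logModulus_zero (ν : ℝ) : logModulus ν 0 = 0 := by simp [logModulus]

lemma logModulus_of_pos {ν t : ℝ} (ht : 0 < t) :
    logModulus ν t = (max ν (-Real.log t)) ^ (-ν) := by simp [logModulus, not_le.2 ht]

lemma logModulus_nonneg {ν : ℝ} (hν : 0 < ν) (t : ℝ) : 0 ≤ logModulus ν t := by
  unfold logModulus
  split_ifs
  · exact le_rfl
  · exact Real.rpow_nonneg (hν.le.trans (le_max_left _ _)) _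

lemma logModulus_le {ν : ℝ} (hν : 0 < ν) (t : ℝ) : logModulus ν t ≤ ν ^ (-ν) := by
  unfold logModulus
  split_ifs
  · positivity
  · exact Real.rpow_le_rpow_of_nonpos hν (le_max_left _ _) (by linarith)

lemma logModulus_mono {ν : ℝ} (hν : 0 < ν) : Monotone (logModulus ν) := by
  intro s t hst
  rcases le_or_gt s 0 with hs | hs
  · simpa [logModulus, hs] using logModulus_nonneg hν t
  · rw [logModulus_of_pos hs, logModulus_of_pos (hs.trans_le hst)]
    exact Real.rpow_le_rpow_of_nonpos (hν.trans_le (le_max_left _ _))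
      (max_le_max_left _ (neg_le_neg (Real.log_le_log hs hst))) (by linarith)

/-- The quotient `logModulus ν t / t` is nonincreasing, whence the subadditivity. -/
lemma mul_logModulus_le {ν s t : ℝ} (hν : 0 < ν) (hs : 0 < s) (hst : s ≤ t) :
    s * logModulus ν t ≤ t * logModulus ν s := by
  have ht := hs.trans_le hst
  rw [logModulus_of_pos hs, logModulus_of_pos ht]
  set a := max ν (-Real.log s) with ha
  set b := max ν (-Real.log t) with hb
  have hb0 : 0 < b := hν.trans_le (le_max_left _ _)
  have ha0 : 0 < a := hν.trans_le (le_max_left _ _)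
  have hlog : Real.log s ≤ Real.log t := Real.log_le_log hs hst
  have hab : a ≤ b + (Real.log t - Real.log s) := by
    apply max_le
    · have := le_max_left ν (-Real.log t); linarith
    · have := le_max_right ν (-Real.log t); linarith
  have h1 : a / b ≤ Real.exp ((Real.log t - Real.log s) / b) := by
    refine le_trans ?_ (Real.add_one_le_exp _)
    rw [div_add_one hb0.ne']
    gcongr
    linarith
  have h2 : (a / b) ^ ν ≤ t / s := by
    calc (a / b) ^ ν ≤ (Real.exp ((Real.log t - Real.log s) / b)) ^ ν := by gcongr
      _ = Real.exp ((Real.log t - Real.log s) * (ν / b)) := by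
          rw [← Real.exp_mul]; congr 1; ring
      _ ≤ Real.exp (Real.log t - Real.log s) := by
          apply Real.exp_le_exp.2
          apply mul_le_of_le_one_right (by linarith)
          exact (div_le_one hb0).2 (le_max_left _ _)
      _ = t / s := by rw [Real.exp_sub, Real.exp_log ht, Real.exp_log hs]
  rw [Real.div_rpow ha0.le hb0.le, div_le_div_iff₀ (by positivity) hs] at h2
  rw [Real.rpow_neg ha0.le, Real.rpow_neg hb0.le, ← div_eq_mul_inv, ← div_eq_mul_inv,
    div_le_div_iff₀ (by positivity) (by positivity)]
  linarith

lemma logModulus_add_le {ν s t : ℝ} (hν : 0 < ν) (hs : 0 ≤ s) (ht : 0 ≤ t) :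
    logModulus ν (s + t) ≤ logModulus ν s + logModulus ν t := by
  rcases hs.eq_or_lt with rfl | hs
  · simp [logModulus_zero]
  rcases ht.eq_or_lt with rfl | ht
  · simp [logModulus_zero]
  have h1 := mul_logModulus_le hν hs (le_add_of_nonneg_right ht.le)
  have h2 := mul_logModulus_le hν ht (le_add_of_nonneg_left hs.le)
  have h3 : (s + t) * logModulus ν (s + t) ≤ (s + t) * (logModulus ν s + logModulus ν t) := by
    linarith
  exact le_of_mul_le_mul_left h3 (by positivity)

lemma continuous_of_logModulus {ν M : ℝ} (hν : 0 < ν) {F : ℂ → ℂ}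
    (hF : ∀ x y, ‖F x - F y‖ ≤ M * logModulus ν ‖x - y‖) : Continuous F := by
  have hlim : Filter.Tendsto (logModulus ν) (nhdsWithin 0 (Set.Ioi 0)) (nhds 0) := by
    have h1 : Filter.Tendsto (fun t : ℝ => (-Real.log t) ^ (-ν)) (nhdsWithin 0 (Set.Ioi 0))
        (nhds 0) :=
      (tendsto_rpow_neg_atTop hν).comp
        (Filter.tendsto_neg_atBot_atTop.comp Real.tendsto_log_nhdsGT_zero)
    refine squeeze_zero' (Filter.Eventually.of_forall fun t => logModulus_nonneg hν t) ?_ h1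
    have h2 : ∀ᶠ t : ℝ in nhdsWithin 0 (Set.Ioi 0), 0 < -Real.log t :=
      (Filter.tendsto_neg_atBot_atTop.comp Real.tendsto_log_nhdsGT_zero).eventually_gt_atTop 0
    filter_upwards [h2, self_mem_nhdsWithin] with t ht ht0
    rw [logModulus_of_pos ht0]
    exact Real.rpow_le_rpow_of_nonpos ht (le_max_right _ _) (by linarith)
  have hlim' : Filter.Tendsto (logModulus ν) (nhds 0) (nhds 0) := by
    have hle : Filter.Tendsto (logModulus ν) (nhdsWithin 0 (Set.Iic 0)) (nhds 0) := by
      refine tendsto_const_nhds.congr' ?_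
      filter_upwards [self_mem_nhdsWithin] with t ht
      simp [logModulus, Set.mem_Iic.1 ht]
    have hsup := hle.sup hlim
    rwa [nhdsLE_sup_nhdsGT] at hsup
  rw [continuous_iff_continuousAt]
  intro y
  rw [ContinuousAt, tendsto_iff_norm_sub_tendsto_zero]
  refine squeeze_zero (fun _ => norm_nonneg _) (fun x => hF x y) ?_
  have h3 : Filter.Tendsto (fun x : ℂ => ‖x - y‖) (nhds y) (nhds 0) :=
    tendsto_iff_norm_sub_tendsto_zero.1 Filter.tendsto_id
  simpa using (hlim'.comp h3).const_mul M

/-! ### Extension of functions with a given modulus of continuity -/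

/-- **McShane extension** for a subadditive modulus `ω`: it is the Lipschitz extension theorem for
the pseudometric `ω (dist x y)`. -/
lemma exists_extension_real {X : Type*} [PseudoMetricSpace X] {ω : ℝ → ℝ} (hmono : Monotone ω)
    (h0 : ω 0 = 0) (hadd : ∀ s t, 0 ≤ s → 0 ≤ t → ω (s + t) ≤ ω s + ω t) {S : Set X} {f : X → ℝ}
    (hf : ∀ x ∈ S, ∀ y ∈ S, |f x - f y| ≤ ω (dist x y)) :
    ∃ g : X → ℝ, Set.EqOn f g S ∧ ∀ x y, |g x - g y| ≤ ω (dist x y) := by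
  let m : PseudoMetricSpace X :=
    { dist := fun x y => ω (dist x y)
      dist_self := fun x => by simp [h0]
      dist_comm := fun x y => by simp [dist_comm]
      dist_triangle := fun x y z => (hmono (dist_triangle x y z)).trans
        (hadd _ _ dist_nonneg dist_nonneg) }
  have h1 : @LipschitzOnWith X ℝ m.toPseudoEMetricSpace _ 1 f S :=
    @LipschitzOnWith.of_dist_le_mul X ℝ m _ 1 S f fun x hx y hy => by
      rw [NNReal.coe_one, one_mul, Real.dist_eq]
      exact hf x hx y hy
  obtain ⟨g, hg, hfg⟩ := @LipschitzOnWith.extend_real X m f S 1 h1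
  refine ⟨g, hfg, fun x y => ?_⟩
  have := @LipschitzWith.dist_le_mul X ℝ m _ 1 g hg x y
  rw [NNReal.coe_one, one_mul, Real.dist_eq] at this
  exact this

lemma exists_extension_complex {X : Type*} [PseudoMetricSpace X] {ω : ℝ → ℝ} (hmono : Monotone ω)
    (h0 : ω 0 = 0) (hadd : ∀ s t, 0 ≤ s → 0 ≤ t → ω (s + t) ≤ ω s + ω t) {S : Set X} {f : X → ℂ}
    (hf : ∀ x ∈ S, ∀ y ∈ S, ‖f x - f y‖ ≤ ω (dist x y)) :
    ∃ g : X → ℂ, Set.EqOn f g S ∧ ∀ x y, ‖g x - g y‖ ≤ 2 * ω (dist x y) := by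
  obtain ⟨a, ha, ha'⟩ := exists_extension_real (f := fun x => (f x).re) hmono h0 hadd
    fun x hx y hy => (Complex.abs_re_le_norm (f x - f y)).trans (hf x hx y hy)
  obtain ⟨b, hb, hb'⟩ := exists_extension_real (f := fun x => (f x).im) hmono h0 hadd
    fun x hx y hy => (Complex.abs_im_le_norm (f x - f y)).trans (hf x hx y hy)
  refine ⟨fun x => ⟨a x, b x⟩, fun x hx => Complex.ext (ha hx) (hb hx), fun x y => ?_⟩
  refine (Complex.norm_le_abs_re_add_abs_im _).trans ?_
  have h1 := ha' x y
  have h2 := hb' x y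
  simp only [Complex.sub_re, Complex.sub_im]
  linarith

/-! ### A smooth annular piece of the Cauchy kernel -/

/-- The piece of the Cauchy kernel `1 / z` at unit scale: a smooth cutoff of `1 / z` to the annulus
`1/2 ≤ |z| ≤ √2`. Its dilates `ε⁻¹ k(z / ε)`, `ε = 2⁻ʲ`, add up to `1 / z` near the origin. -/
noncomputable def annularKernel (z : ℂ) : ℂ :=
  ((Real.smoothTransition (2 - ‖z‖ ^ 2) - Real.smoothTransition (2 - 4 * ‖z‖ ^ 2) : ℝ) : ℂ) * z⁻¹

/-- The nonnegative radial bump `-h'(|w|²)`, where `h s = smoothTransition (2 - s)`: it is the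
`∂/∂z̄`-derivative, up to sign, of `h(|w|²) / w` away from the origin. -/
noncomputable def radialBump (w : ℂ) : ℝ := deriv Real.smoothTransition (2 - ‖w‖ ^ 2)

lemma annularKernel_eq_zero_of_le {z : ℂ} (hz : ‖z‖ ≤ 1 / 2) : annularKernel z = 0 := by
  have h1 : ‖z‖ ^ 2 ≤ 1 / 4 := by nlinarith [norm_nonneg z]
  rw [annularKernel, Real.smoothTransition.one_of_one_le (by linarith),
    Real.smoothTransition.one_of_one_le (by linarith)]
  simp

lemma annularKernel_eq_zero_of_ge {z : ℂ} (hz : 2 ≤ ‖z‖) : annularKernel z = 0 := by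
  have h1 : 4 ≤ ‖z‖ ^ 2 := by nlinarith [norm_nonneg z]
  rw [annularKernel, Real.smoothTransition.zero_of_nonpos (by linarith),
    Real.smoothTransition.zero_of_nonpos (by linarith)]
  simp

lemma annularKernel_eventuallyEq_zero : annularKernel =ᶠ[nhds 0] fun _ => 0 := by
  filter_upwards [Metric.closedBall_mem_nhds (0 : ℂ) (by norm_num : (0 : ℝ) < 1 / 2)] with w hw
  exact annularKernel_eq_zero_of_le (by simpa using hw)

lemma hasCompactSupport_annularKernel : HasCompactSupport annularKernel := by
  refine HasCompactSupport.intro (isCompact_closedBall (0 : ℂ) 2) fun z hz => ?_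
  exact annularKernel_eq_zero_of_ge (by simpa using (not_le.1 (by simpa using hz)).le)

lemma contDiff_annularKernel : ContDiff ℝ 2 annularKernel := by
  rw [contDiff_iff_contDiffAt]
  intro z
  rcases eq_or_ne z 0 with rfl | hz
  · exact contDiffAt_const.congr_of_eventuallyEq annularKernel_eventuallyEq_zero
  · have hσ : ContDiff ℝ 2 Real.smoothTransition := Real.smoothTransition.contDiff
    have hn : ContDiff ℝ 2 fun z : ℂ => ‖z‖ ^ 2 := contDiff_norm_sq ℝ
    have hq : ContDiff ℝ 2 fun z : ℂ => Real.smoothTransition (2 - ‖z‖ ^ 2) -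
        Real.smoothTransition (2 - 4 * ‖z‖ ^ 2) :=
      (hσ.comp (contDiff_const.sub hn)).sub (hσ.comp (contDiff_const.sub (contDiff_const.mul hn)))
    exact (Complex.ofRealCLM.contDiff.comp hq).contDiffAt.mul (contDiffAt_inv ℝ hz)

lemma deriv_smoothTransition_of_one_le {x : ℝ} (hx : 1 ≤ x) :
    deriv Real.smoothTransition x = 0 := by
  have hmax : IsLocalMax Real.smoothTransition x := Filter.Eventually.of_forall fun y => by
    rw [Real.smoothTransition.one_of_one_le hx]; exact Real.smoothTransition.le_one y
  exact hmax.deriv_eq_zero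

lemma deriv_smoothTransition_of_nonpos {x : ℝ} (hx : x ≤ 0) :
    deriv Real.smoothTransition x = 0 := by
  have hmin : IsLocalMin Real.smoothTransition x := Filter.Eventually.of_forall fun y => by
    rw [Real.smoothTransition.zero_of_nonpos hx]; exact Real.smoothTransition.nonneg y
  exact hmin.deriv_eq_zero

lemma radialBump_eq_zero_of_le {w : ℂ} (hw : ‖w‖ ≤ 1) : radialBump w = 0 :=
  deriv_smoothTransition_of_one_le (by nlinarith [norm_nonneg w])

lemma radialBump_eq_zero_of_ge {w : ℂ} (hw : 2 ≤ ‖w‖) : radialBump w = 0 :=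
  deriv_smoothTransition_of_nonpos (by nlinarith [norm_nonneg w])

lemma continuous_radialBump : Continuous radialBump := by
  have h : ContDiff ℝ 1 Real.smoothTransition := Real.smoothTransition.contDiff
  have h' := h.continuous_deriv le_rfl
  unfold radialBump
  fun_prop

lemma hasCompactSupport_radialBump : HasCompactSupport radialBump := by
  refine HasCompactSupport.intro (isCompact_closedBall (0 : ℂ) 2) fun z hz => ?_
  exact radialBump_eq_zero_of_ge (by simpa using (not_le.1 (by simpa using hz)).le)

lemma integral_radialBump_pos : 0 < ∫ w, radialBump w := by
  have hd : Differentiable ℝ Real.smoothTransition :=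
    (Real.smoothTransition.contDiff (n := 1)).differentiable (by norm_num)
  obtain ⟨c, hc, hc'⟩ := exists_deriv_eq_slope Real.smoothTransition (zero_lt_one' ℝ)
    hd.continuous.continuousOn hd.differentiableOn
  rw [Real.smoothTransition.one, Real.smoothTransition.zero] at hc'
  refine continuous_radialBump.integral_pos_of_hasCompactSupport_nonneg_nonzero
    (x := ((√(2 - c) : ℝ) : ℂ)) hasCompactSupport_radialBump
    (fun w => Real.smoothTransition.monotone.deriv_nonneg) ?_
  have h2 : 0 ≤ 2 - c := by linarith [hc.2]
  rw [radialBump, Complex.norm_real, Real.norm_eq_abs, sq_abs, Real.sq_sqrt h2]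
  norm_num [hc']

/-- The `∂/∂z̄`-derivative of the annular kernel is a difference of two dilates of the radial bump;
this makes the sum over dyadic scales telescope. -/
lemma dbar_annularKernel (z : ℂ) :
    (fderiv ℝ annularKernel z 1 + Complex.I * fderiv ℝ annularKernel z Complex.I) / 2 =
      ((4 * radialBump ((2 : ℝ) • z) - radialBump z : ℝ) : ℂ) := by
  rcases eq_or_ne z 0 with rfl | hz
  · rw [annularKernel_eventuallyEq_zero.fderiv_eq]
    simp [radialBump_eq_zero_of_le]
  have hd : Differentiable ℝ Real.smoothTransition :=
    (Real.smoothTransition.contDiff (n := 1)).differentiable (by norm_num)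
  have hn : HasFDerivAt (fun z : ℂ => ‖z‖ ^ 2) (2 • innerSL ℝ z) z :=
    (hasStrictFDerivAt_norm_sq z).hasFDerivAt
  have h1 := (hd (2 - ‖z‖ ^ 2)).hasDerivAt.comp_hasFDerivAt z (hn.const_sub 2)
  have h2 := (hd (2 - 4 * ‖z‖ ^ 2)).hasDerivAt.comp_hasFDerivAt z ((hn.const_mul 4).const_sub 2)
  have h3 := Complex.ofRealCLM.hasFDerivAt.comp z (h1.sub h2)
  have h4 := ((hasDerivAt_inv hz).hasFDerivAt).restrictScalars ℝ
  have h5 : HasFDerivAt annularKernel _ z := h3.mul h4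
  rw [h5.fderiv]
  have h6 : radialBump ((2 : ℝ) • z) = deriv Real.smoothTransition (2 - 4 * ‖z‖ ^ 2) := by
    rw [radialBump, norm_smul, mul_pow]; norm_num
  rw [h6, radialBump]
  set a := deriv Real.smoothTransition (2 - 4 * ‖z‖ ^ 2)
  set b := deriv Real.smoothTransition (2 - ‖z‖ ^ 2)
  have hz' : ((z.re : ℂ) + z.im * Complex.I) * z⁻¹ = 1 := by
    rw [Complex.re_add_im, mul_inv_cancel₀ hz]
  simp [Complex.inner]
  linear_combination ((4 : ℂ) * a - b) * hz' - 1 / 2 * z⁻¹ ^ 2 *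
    ((Real.smoothTransition (2 - ‖z‖ ^ 2) : ℂ) - Real.smoothTransition (2 - 4 * ‖z‖ ^ 2)) *
      Complex.I_sq

/-! ### Convolution with kernels of mean zero -/

open MeasureTheory

lemma hasFDerivAt_integral_mul_sub {G k : ℂ → ℂ} (hG : Continuous G) (hk : ContDiff ℝ 1 k)
    (hc : HasCompactSupport k) (x : ℂ) :
    HasFDerivAt (fun x => ∫ t, G t * k (x - t)) (∫ t, G t • fderiv ℝ k (x - t)) x := by
  exact hc.hasFDerivAt_convolution_right (μ := volume) (ContinuousLinearMap.mul ℝ ℂ)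
    hG.locallyIntegrable hk x

lemma integral_fderiv_eq_zero {k : ℂ → ℂ} (hk : ContDiff ℝ 1 k) (hc : HasCompactSupport k) :
    ∫ t, fderiv ℝ k t = 0 := by
  have h := hasFDerivAt_integral_mul_sub (G := fun _ => 1) continuous_const hk hc 0
  simp only [one_mul, one_smul] at h
  have h1 : (fun x => ∫ t, k (x - t)) = fun _ => ∫ t, k t := by
    ext x; exact integral_sub_left_eq_self k volume x
  rw [h1, integral_sub_left_eq_self (fun t => fderiv ℝ k t) volume 0] at h
  exact h.unique (hasFDerivAt_const _ _)

/-- Integrating against a kernel of mean zero sees only the oscillation of the function. -/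
lemma norm_integral_smul_le_of_integral_eq_zero {E : Type*} [NormedAddCommGroup E]
    [NormedSpace ℂ E] {Φ : ℂ → E} {G : ℂ → ℂ} {x : ℂ} {r B m : ℝ} (hG : Continuous G)
    (hΦ : Continuous Φ) (hsupp : ∀ t, r < ‖t - x‖ → Φ t = 0) (hB : ∀ t, ‖Φ t‖ ≤ B)
    (hint : ∫ t, Φ t = 0) (hm : ∀ t, ‖t - x‖ ≤ r → ‖G t - G x‖ ≤ m) :
    ‖∫ t, G t • Φ t‖ ≤ m * B * volume.real (Metric.closedBall x r) := by
  have hzero : ∀ t, t ∉ Metric.closedBall x r → Φ t = 0 := fun t ht =>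
    hsupp t (by simpa [dist_eq_norm] using ht)
  have hcs : HasCompactSupport Φ := HasCompactSupport.intro (isCompact_closedBall x r) hzero
  have h1 : ∫ t, G t • Φ t = ∫ t, (G t - G x) • Φ t := by
    have i1 : Integrable fun t => G t • Φ t :=
      (hG.smul hΦ).integrable_of_hasCompactSupport hcs.smul_left
    have i2 : Integrable fun t => G x • Φ t :=
      (hΦ.integrable_of_hasCompactSupport hcs).smul (G x)
    simp only [sub_smul]
    rw [integral_sub i1 i2, integral_smul, hint, smul_zero, sub_zero]
  rw [h1, ← setIntegral_eq_integral_of_forall_compl_eq_zero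
    (s := Metric.closedBall x r) fun t ht => by rw [hzero t ht, smul_zero]]
  refine norm_setIntegral_le_of_norm_le_const measure_closedBall_lt_top fun t ht => ?_
  rw [norm_smul]
  have h2 := hm t (by simpa [dist_eq_norm] using ht)
  exact mul_le_mul h2 (hB t) (norm_nonneg _) ((norm_nonneg _).trans h2)

/-- The gradient of the convolution with the annular kernel is bounded and Lipschitz, with constants
controlled by the oscillation of the function at unit scale. -/
lemma exists_bound_integral_smul_fderiv : ∃ B : ℝ, 0 ≤ B ∧ ∀ (G : ℂ → ℂ) (m : ℝ), Continuous G →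
    (∀ s t, ‖s - t‖ ≤ 3 → ‖G s - G t‖ ≤ m) →
    (∀ x, ‖∫ t, G t • fderiv ℝ annularKernel (x - t)‖ ≤ B * m) ∧
    ∀ x y, ‖(∫ t, G t • fderiv ℝ annularKernel (x - t)) -
      ∫ t, G t • fderiv ℝ annularKernel (y - t)‖ ≤ B * m * ‖x - y‖ := by
  have hk : ContDiff ℝ 1 annularKernel := contDiff_annularKernel.of_le one_le_two
  have hk' : ContDiff ℝ 1 (fderiv ℝ annularKernel) :=
    contDiff_annularKernel.fderiv_right (by norm_num)
  have hcs := hasCompactSupport_annularKernel.fderiv (𝕜 := ℝ)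
  have hc := hk'.continuous
  obtain ⟨L, hL⟩ := hk'.lipschitzWith_of_hasCompactSupport hcs one_ne_zero
  obtain ⟨K, hK⟩ := hcs.exists_bound_of_continuous hc
  have hK0 : 0 ≤ K := (norm_nonneg _).trans (hK 0)
  have hsupp : ∀ t : ℂ, 2 < ‖t‖ → fderiv ℝ annularKernel t = 0 := fun t ht => by
    have : annularKernel =ᶠ[nhds t] fun _ => 0 := by
      filter_upwards [(isOpen_lt continuous_const continuous_norm).mem_nhds ht] with w hw
      exact annularKernel_eq_zero_of_ge (le_of_lt hw)
    rw [this.fderiv_eq]; simp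
  have hint := integral_fderiv_eq_zero hk hasCompactSupport_annularKernel
  have hint' : ∀ x, ∫ t, fderiv ℝ annularKernel (x - t) = 0 := fun x => by
    rw [integral_sub_left_eq_self (fun t => fderiv ℝ annularKernel t) volume x, hint]
  set V := volume.real (Metric.closedBall (0 : ℂ) 3) with hV
  have hV0 : 0 ≤ V := measureReal_nonneg
  have hVx : ∀ x : ℂ, volume.real (Metric.closedBall x 3) = V := fun x => by
    rw [hV, Measure.real, Measure.real, Measure.addHaar_closedBall_center]
  have hcx : ∀ x : ℂ, Continuous fun t => fderiv ℝ annularKernel (x - t) := fun x => by fun_prop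
  refine ⟨2 * K * V + L * V, by positivity, fun G m hG hm => ?_⟩
  have hm0 : 0 ≤ m := (norm_nonneg _).trans (hm 0 0 (by simp))
  have hbd : ∀ x, ‖∫ t, G t • fderiv ℝ annularKernel (x - t)‖ ≤ K * V * m := fun x => by
    have := norm_integral_smul_le_of_integral_eq_zero (x := x) (r := 3) (B := K) (m := m) hG
      (hcx x) (fun t ht => hsupp _ (by rw [norm_sub_rev]; linarith)) (fun t => hK _) (hint' x)
      fun t ht => hm t x ht
    rw [hVx] at this
    linarith
  have h0 : 0 ≤ L * V * m := by positivity
  have h0' : 0 ≤ K * V * m := by positivity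
  refine ⟨fun x => (hbd x).trans (by linarith), fun x y => ?_⟩
  have hint2 : ∀ x, Integrable fun t => G t • fderiv ℝ annularKernel (x - t) := fun x =>
    (hG.smul (hcx x)).integrable_of_hasCompactSupport
      (HasCompactSupport.smul_left (HasCompactSupport.intro (isCompact_closedBall x 2)
        fun t ht => hsupp _ (by
          rw [norm_sub_rev]; simpa [dist_eq_norm] using ht)))
  have hint1 : ∀ x, Integrable fun t => fderiv ℝ annularKernel (x - t) := fun x =>
    (hc.integrable_of_hasCompactSupport hcs).comp_sub_left x
  -- For `‖x - y‖ ≤ 1` the difference of the two kernels lives on the disc of radius `3` about `x`.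
  rcases le_or_gt ‖x - y‖ 1 with hxy | hxy
  · rw [← integral_sub (hint2 x) (hint2 y)]
    simp only [← smul_sub]
    have := norm_integral_smul_le_of_integral_eq_zero (x := x) (r := 3) (B := L * ‖x - y‖)
      (m := m) (Φ := fun t => fderiv ℝ annularKernel (x - t) - fderiv ℝ annularKernel (y - t)) hG
      ((hcx x).sub (hcx y)) (fun t ht => by
        rw [hsupp _ (by rw [norm_sub_rev]; linarith), hsupp (y - t), sub_zero]
        have h1 : ‖t - x‖ ≤ ‖y - t‖ + ‖x - y‖ := by
          have := norm_add_le (y - t) (x - y)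
          rwa [show y - t + (x - y) = -(t - x) by ring, norm_neg] at this
        linarith)
      (fun t => by simpa using hL.norm_sub_le (x - t) (y - t))
      (by rw [integral_sub (hint1 x) (hint1 y), hint' x, hint' y, sub_zero])
      fun t ht => hm t x ht
    rw [hVx] at this
    refine this.trans ?_
    have h3 : 0 ≤ 2 * K * V * m * ‖x - y‖ := by positivity
    linarith
  · calc _ ≤ K * V * m + K * V * m := (norm_sub_le _ _).trans (add_le_add (hbd x) (hbd y))
      _ ≤ (2 * K * V + L * V) * m * 1 := by linarith
      _ ≤ _ := by gcongr

lemma exists_bound_integral_mul : ∃ B : ℝ, 0 ≤ B ∧ ∀ (G : ℂ → ℂ) (A : ℝ),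
    (∀ t, ‖G t‖ ≤ A) → ∀ x, ‖∫ t, G t * annularKernel (x - t)‖ ≤ A * B := by
  refine ⟨∫ t, ‖annularKernel t‖, by positivity, fun G A hA x => ?_⟩
  have hi : Integrable annularKernel :=
    contDiff_annularKernel.continuous.integrable_of_hasCompactSupport
      hasCompactSupport_annularKernel
  rw [← integral_sub_left_eq_self (fun t => ‖annularKernel t‖) volume x, ← integral_const_mul]
  refine norm_integral_le_of_norm_le ((hi.norm.comp_sub_left x).const_mul A)
    (Filter.Eventually.of_forall fun t => ?_)
  rw [norm_mul]
  exact mul_le_mul_of_nonneg_right (hA t) (norm_nonneg _)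

/-! ### Potentials at a single scale -/

/-- The convolution of `F` with the dilated kernel `ε⁻¹ k(z / ε)`, `k` the annular kernel, written
in rescaled variables. -/
noncomputable def scalePotential (F : ℂ → ℂ) (ε : ℝ) (z : ℂ) : ℂ :=
  ε • ∫ t, F (ε • t) * annularKernel (ε⁻¹ • z - t)

/-- The derivative of `scalePotential F ε`. -/
noncomputable def scaleGradient (F : ℂ → ℂ) (ε : ℝ) (z : ℂ) : ℂ →L[ℝ] ℂ :=
  ∫ t, F (ε • t) • fderiv ℝ annularKernel (ε⁻¹ • z - t)

/-- The average of `F` around `z` at scale `ε`, weighted by the radial bump (not normalized). -/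
noncomputable def bumpMean (F : ℂ → ℂ) (ε : ℝ) (z : ℂ) : ℂ :=
  ∫ w, F (z - ε • w) * (radialBump w : ℂ)

/-- The coefficient of `dz̄` in a real-linear form: `A ↦ (A 1 + i A i) / 2`. -/
noncomputable def dbarCoeff : (ℂ →L[ℝ] ℂ) →L[ℝ] ℂ :=
  (2⁻¹ : ℂ) • (ContinuousLinearMap.apply ℝ ℂ (1 : ℂ) +
    Complex.I • ContinuousLinearMap.apply ℝ ℂ Complex.I)

lemma dbarCoeff_apply (A : ℂ →L[ℝ] ℂ) : dbarCoeff A = (A 1 + Complex.I * A Complex.I) / 2 := by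
  simp [dbarCoeff]; ring

lemma dbarCoeff_smul (c : ℂ) (A : ℂ →L[ℝ] ℂ) : dbarCoeff (c • A) = c * dbarCoeff A := by
  simp [dbarCoeff_apply]; ring

lemma hasFDerivAt_scalePotential {F : ℂ → ℂ} (hF : Continuous F) {ε : ℝ} (hε : 0 < ε) (z : ℂ) :
    HasFDerivAt (scalePotential F ε) (scaleGradient F ε z) z := by
  have h1 := hasFDerivAt_integral_mul_sub (G := fun t => F (ε • t)) (by fun_prop)
    (contDiff_annularKernel.of_le one_le_two) hasCompactSupport_annularKernel (ε⁻¹ • z)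
  have h2 : HasFDerivAt (fun z : ℂ => ε⁻¹ • z) (ε⁻¹ • ContinuousLinearMap.id ℝ ℂ) z :=
    (hasFDerivAt_id z).const_smul ε⁻¹
  have h3 := (h1.comp z h2).const_smul ε
  have h4 : scaleGradient F ε z = ε • (∫ t, F (ε • t) • fderiv ℝ annularKernel (ε⁻¹ • z - t)).comp
      (ε⁻¹ • ContinuousLinearMap.id ℝ ℂ) := by
    ext v
    simp [scaleGradient, hε.ne']
  rw [h4]
  exact h3

/-- At a single scale, the `∂/∂z̄`-derivative is a difference of averages at consecutive scales. -/
lemma dbarCoeff_scaleGradient {F : ℂ → ℂ} (hF : Continuous F) {ε : ℝ} (hε : 0 < ε) (z : ℂ) :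
    dbarCoeff (scaleGradient F ε z) = bumpMean F (ε / 2) z - bumpMean F ε z := by
  have hc : Continuous (fderiv ℝ annularKernel) :=
    contDiff_annularKernel.continuous_fderiv two_ne_zero
  have hcs := hasCompactSupport_annularKernel.fderiv (𝕜 := ℝ)
  have hFc : ∀ δ : ℝ, Continuous fun t : ℂ => F (z - δ • t) := fun δ => by fun_prop
  have hi : Integrable fun t => F (z - ε • t) • fderiv ℝ annularKernel t :=
    ((hFc ε).smul hc).integrable_of_hasCompactSupport hcs.smul_left
  have h1 : scaleGradient F ε z = ∫ t, F (z - ε • t) • fderiv ℝ annularKernel t := by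
    rw [scaleGradient, ← integral_sub_left_eq_self _ volume (ε⁻¹ • z)]
    congr 1; ext1 t
    rw [sub_sub_cancel, smul_sub, smul_inv_smul₀ hε.ne']
  have hb : Continuous fun t => (radialBump t : ℂ) :=
    Complex.continuous_ofReal.comp continuous_radialBump
  have hbs : HasCompactSupport fun t => (radialBump t : ℂ) :=
    hasCompactSupport_radialBump.comp_left Complex.ofReal_zero
  have i0 : ∀ δ : ℝ, Integrable fun t => F (z - δ • t) * (radialBump t : ℂ) := fun δ =>
    ((hFc δ).mul hb).integrable_of_hasCompactSupport hbs.mul_left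
  have h2 : ∫ t : ℂ, F (z - (ε / 2) • (2 : ℝ) • t) * (radialBump ((2 : ℝ) • t) : ℂ) =
      4⁻¹ * bumpMean F (ε / 2) z := by
    rw [Measure.integral_comp_smul volume
      (fun t => F (z - (ε / 2) • t) * (radialBump t : ℂ)) (2 : ℝ), bumpMean,
      Complex.finrank_real_complex, Complex.real_smul]
    norm_num
  have i3 : Integrable fun t : ℂ =>
      F (z - (ε / 2) • (2 : ℝ) • t) * (radialBump ((2 : ℝ) • t) : ℂ) :=
    (i0 (ε / 2)).comp_smul two_ne_zero
  rw [h1, ← dbarCoeff.integral_comp_comm hi]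
  have h3 : ∀ t, dbarCoeff (F (z - ε • t) • fderiv ℝ annularKernel t) =
      4 * (F (z - (ε / 2) • (2 : ℝ) • t) * (radialBump ((2 : ℝ) • t) : ℂ)) -
        F (z - ε • t) * (radialBump t : ℂ) := fun t => by
    rw [dbarCoeff_smul, dbarCoeff_apply, dbar_annularKernel, smul_smul,
      div_mul_cancel₀ ε two_ne_zero]
    push_cast; ring
  simp only [h3]
  rw [integral_sub (i3.const_mul 4) (i0 ε), integral_const_mul, h2, bumpMean, bumpMean]
  ring

lemma tendsto_bumpMean {F : ℂ → ℂ} (hF : Continuous F) {A : ℝ} (hA : ∀ x, ‖F x‖ ≤ A) (z : ℂ) :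
    Filter.Tendsto (fun ε => bumpMean F ε z) (nhds 0)
      (nhds (F z * ((∫ w, radialBump w : ℝ) : ℂ))) := by
  have hb := continuous_radialBump
  have hi : Integrable radialBump :=
    hb.integrable_of_hasCompactSupport hasCompactSupport_radialBump
  rw [← integral_complex_ofReal, ← integral_const_mul]
  refine tendsto_integral_filter_of_dominated_convergence (fun w => A * ‖radialBump w‖)
    (Filter.Eventually.of_forall fun ε => Continuous.aestronglyMeasurable (by fun_prop))
    (Filter.Eventually.of_forall fun ε => Filter.Eventually.of_forall fun w => ?_)
    (hi.norm.const_mul A) (Filter.Eventually.of_forall fun w => ?_)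
  · rw [norm_mul, Complex.norm_real]
    exact mul_le_mul_of_nonneg_right (hA _) (norm_nonneg _)
  · have h : Continuous fun ε : ℝ => F (z - ε • w) * (radialBump w : ℂ) := by fun_prop
    simpa using h.tendsto 0

/-- At the scale `2R` the bump, which vanishes on the unit disc, only sees values of `F` outside the
disc of radius `R`. -/
lemma bumpMean_eq_zero {F : ℂ → ℂ} {R : ℝ} (hR : 0 < R) (hF : ∀ x, R ≤ ‖x‖ → F x = 0) {z : ℂ}
    (hz : ‖z‖ ≤ R) : bumpMean F (2 * R) z = 0 := by
  refine integral_eq_zero_of_ae (Filter.Eventually.of_forall fun w => ?_)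
  change F (z - (2 * R) • w) * (radialBump w : ℂ) = 0
  rcases le_or_gt ‖w‖ 1 with hw | hw
  · simp [radialBump_eq_zero_of_le hw]
  · rw [hF, zero_mul]
    have h1 := norm_sub_norm_le ((2 * R) • w) z
    rw [norm_sub_rev, norm_smul, Real.norm_eq_abs, abs_of_pos (by positivity)] at h1
    nlinarith

/-! ### Sums over dyadic scales -/

lemma exists_logModulus_dyadic_le {ν a : ℝ} (hν : 0 < ν) (ha : 0 < a) :
    ∃ C : ℝ, 0 ≤ C ∧ ∀ j : ℕ, logModulus ν (a * (1 / 2) ^ j) ≤ C * ((j : ℝ) + 1) ^ (-ν) := by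
  have hl2 : 0 < Real.log 2 := Real.log_pos one_lt_two
  set b := Real.log 2 + |Real.log a| with hb
  have hb0 : 0 < b := by positivity
  set c := Real.log 2 / (1 + b / ν) with hc
  have hc0 : 0 < c := by positivity
  refine ⟨c ^ (-ν), by positivity, fun j => ?_⟩
  rw [logModulus_of_pos (by positivity), ← Real.mul_rpow hc0.le (by positivity)]
  refine Real.rpow_le_rpow_of_nonpos (by positivity) ?_ (by linarith)
  rw [Real.log_mul ha.ne' (by positivity), Real.log_pow, one_div, Real.log_inv]
  set m := max ν (-(Real.log a + j * -Real.log 2)) with hm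
  -- A convex combination of the two lower bounds for `m` is linear in `j` without constant term.
  have h1 : ν ≤ m := le_max_left _ _
  have h2 : ((j : ℝ) + 1) * Real.log 2 - b ≤ m := by
    refine le_trans ?_ (le_max_right _ _)
    have := le_abs_self (Real.log a)
    rw [hb]; linarith
  have h3 : b ≤ b / ν * m := by
    calc b = b / ν * ν := by field_simp
      _ ≤ _ := by gcongr
  rw [hc, div_mul_eq_mul_div, div_le_iff₀ (by positivity)]
  linarith

lemma summable_add_one_rpow_neg {ν : ℝ} (hν : 1 < ν) :
    Summable fun j : ℕ => ((j : ℝ) + 1) ^ (-ν) := by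
  have h := (summable_nat_add_iff (f := fun j : ℕ => (j : ℝ) ^ (-ν)) 1).2
    (Real.summable_nat_rpow.2 (by linarith))
  simpa using h

lemma summable_geometric_mul_rpow (ν : ℝ) :
    Summable fun i : ℕ => (1 / 2 : ℝ) ^ i * ((i : ℝ) + 1) ^ ν := by
  have h1 : Summable fun n : ℕ => (n : ℝ) ^ ⌈ν⌉₊ * (1 / 2 : ℝ) ^ n :=
    summable_pow_mul_geometric_of_norm_lt_one _ (by norm_num)
  have h2 := ((summable_nat_add_iff 1).2 h1).mul_left 2
  refine Summable.of_nonneg_of_le (fun i => by positivity) (fun i => ?_) h2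
  have h3 : ((i : ℝ) + 1) ^ ν ≤ ((i : ℝ) + 1) ^ ⌈ν⌉₊ := by
    rw [← Real.rpow_natCast]
    exact Real.rpow_le_rpow_of_exponent_le (by linarith [(Nat.cast_nonneg i : (0 : ℝ) ≤ i)])
      (Nat.le_ceil ν)
  calc (1 / 2 : ℝ) ^ i * ((i : ℝ) + 1) ^ ν ≤ (1 / 2 : ℝ) ^ i * ((i : ℝ) + 1) ^ ⌈ν⌉₊ := by gcongr
    _ = _ := by push_cast; ring

lemma rpow_neg_le_telescope {ν x : ℝ} (hν : 1 < ν) (hx : 0 < x) :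
    (x + 1) ^ (-ν) ≤ (x ^ (-(ν - 1)) - (x + 1) ^ (-(ν - 1))) / (ν - 1) := by
  have hp : 0 < ν - 1 := by linarith
  have hx1 : 0 < x + 1 := by linarith
  have h1 : 1 + (ν - 1) / (x + 1) ≤ (x / (x + 1)) ^ (-(ν - 1)) := by
    rw [Real.rpow_def_of_pos (by positivity)]
    have h2 := Real.log_le_sub_one_of_pos (show 0 < x / (x + 1) by positivity)
    have h3 : x / (x + 1) - 1 = -(1 / (x + 1)) := by field_simp; ring
    have h4 : (ν - 1) / (x + 1) ≤ Real.log (x / (x + 1)) * -(ν - 1) := by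
      rw [h3] at h2
      calc (ν - 1) / (x + 1) = (1 / (x + 1)) * (ν - 1) := by ring
        _ ≤ -Real.log (x / (x + 1)) * (ν - 1) := by gcongr; linarith
        _ = _ := by ring
    linarith [Real.add_one_le_exp (Real.log (x / (x + 1)) * -(ν - 1))]
  rw [Real.div_rpow hx.le hx1.le, le_div_iff₀ (by positivity)] at h1
  have h5 : (x + 1) ^ (-ν) = (x + 1) ^ (-(ν - 1)) / (x + 1) := by
    rw [← Real.rpow_sub_one hx1.ne']; congr 1; ring
  rw [le_div_iff₀ hp, h5]
  have h6 : (1 + (ν - 1) / (x + 1)) * (x + 1) ^ (-(ν - 1)) =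
    (x + 1) ^ (-(ν - 1)) + (x + 1) ^ (-(ν - 1)) / (x + 1) * (ν - 1) := by ring
  linarith

/-- The loss of one power of the logarithm: the scales `2⁻ʲ ≥ d` contribute `|ln d|^(-ν)` and the
scales `2⁻ʲ ≤ d` contribute the tail `|ln d|^(1-ν)` of the series. -/
lemma exists_sum_min_le {ν : ℝ} (hν : 1 < ν) : ∃ C : ℝ, 0 ≤ C ∧ ∀ d : ℝ, 0 < d → d ≤ 1 / 2 →
    ∀ n : ℕ, ∑ j ∈ Finset.range n, min 1 (d * 2 ^ j) * ((j : ℝ) + 1) ^ (-ν) ≤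
      C * |Real.log d| ^ (-(ν - 1)) := by
  have hp : 0 < ν - 1 := by linarith
  set g : ℕ → ℝ := fun i => (1 / 2 : ℝ) ^ i * ((i : ℝ) + 1) ^ ν with hg
  set S := ∑' i, g i with hS
  have hS0 : 0 ≤ S := tsum_nonneg fun i => by positivity
  refine ⟨(S + 1 / (ν - 1)) * 2 ^ (ν - 1), by positivity, fun d hd hd2 n => ?_⟩
  obtain ⟨J, hJ1, hJ2⟩ := exists_nat_pow_near_of_lt_one hd (hd2.trans (by norm_num))
    (by norm_num : (0 : ℝ) < 1 / 2) (by norm_num)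
  have hJ : 1 ≤ J := by
    rcases Nat.eq_zero_or_pos J with rfl | h
    · norm_num at hJ1; linarith
    · exact h
  have hJr : (1 : ℝ) ≤ J := by exact_mod_cast hJ
  set b : ℕ → ℝ := fun j => min 1 (d * 2 ^ j) * ((j : ℝ) + 1) ^ (-ν) with hb
  have hb0 : ∀ j, 0 ≤ b j := fun j => by positivity
  have hlow : ∑ j ∈ Finset.range J, b j ≤ (J : ℝ) ^ (-(ν - 1)) * S := by
    have h1 : ∀ j ∈ Finset.range J, b j ≤ ((J : ℝ) + 1) ^ (-ν) * g (J - j) := fun j hj => by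
      obtain ⟨i, rfl⟩ := Nat.exists_eq_add_of_le (Finset.mem_range.1 hj).le
      rw [Nat.add_sub_cancel_left]
      have h2 : min 1 (d * 2 ^ j) ≤ (1 / 2 : ℝ) ^ i := by
        refine (min_le_right _ _).trans ?_
        calc d * 2 ^ j ≤ (1 / 2) ^ (j + i) * 2 ^ j := by gcongr
          _ = (1 / 2 : ℝ) ^ i * ((1 / 2) * 2) ^ j := by rw [pow_add, mul_pow]; ring
          _ = _ := by norm_num
      have h3 : ((j : ℝ) + 1) ^ (-ν) ≤ (((j + i : ℕ) : ℝ) + 1) ^ (-ν) * ((i : ℝ) + 1) ^ ν := by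
        rw [Real.rpow_neg (by positivity), Real.rpow_neg (by positivity), ← div_eq_inv_mul,
          inv_eq_one_div, div_le_div_iff₀ (by positivity) (by positivity), one_mul,
          ← Real.mul_rpow (by positivity) (by positivity)]
        refine Real.rpow_le_rpow (by positivity) ?_ (by linarith)
        push_cast
        nlinarith [(Nat.cast_nonneg i : (0 : ℝ) ≤ i), (Nat.cast_nonneg j : (0 : ℝ) ≤ j),
          mul_nonneg (Nat.cast_nonneg i : (0 : ℝ) ≤ i) (Nat.cast_nonneg j : (0 : ℝ) ≤ j)]
      calc b j ≤ (1 / 2 : ℝ) ^ i * ((((j + i : ℕ) : ℝ) + 1) ^ (-ν) * ((i : ℝ) + 1) ^ ν) :=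
            mul_le_mul h2 h3 (by positivity) (by positivity)
        _ = _ := by rw [hg]; ring
    have h4 : ∑ j ∈ Finset.range J, g (J - j) ≤ S := by
      calc ∑ j ∈ Finset.range J, g (J - j) ≤ ∑ j ∈ Finset.range (J + 1), g (J - j) :=
            Finset.sum_le_sum_of_subset_of_nonneg (Finset.range_mono (Nat.le_succ J))
              fun _ _ _ => by positivity
        _ = ∑ j ∈ Finset.range (J + 1), g j := Finset.sum_flip g
        _ ≤ S := (summable_geometric_mul_rpow ν).sum_le_tsum _ fun _ _ => by positivity
    have h5 : ((J : ℝ) + 1) ^ (-ν) ≤ (J : ℝ) ^ (-(ν - 1)) :=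
      (Real.rpow_le_rpow_of_exponent_le (by linarith) (by linarith)).trans
        (Real.rpow_le_rpow_of_nonpos (by linarith) (by linarith) (by linarith))
    calc ∑ j ∈ Finset.range J, b j ≤ ∑ j ∈ Finset.range J, ((J : ℝ) + 1) ^ (-ν) * g (J - j) :=
          Finset.sum_le_sum h1
      _ = ((J : ℝ) + 1) ^ (-ν) * ∑ j ∈ Finset.range J, g (J - j) := by rw [Finset.mul_sum]
      _ ≤ _ := mul_le_mul h5 h4 (Finset.sum_nonneg fun _ _ => by positivity) (by positivity)
  have hhigh : ∑ i ∈ Finset.range n, b (J + i) ≤ (J : ℝ) ^ (-(ν - 1)) * (1 / (ν - 1)) := by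
    set t : ℕ → ℝ := fun i => ((J : ℝ) + i) ^ (-(ν - 1)) / (ν - 1) with ht
    have h1 : ∀ i ∈ Finset.range n, b (J + i) ≤ t i - t (i + 1) := fun i _ => by
      have h2 := rpow_neg_le_telescope hν (show (0 : ℝ) < J + i by positivity)
      calc b (J + i) ≤ 1 * (((J + i : ℕ) : ℝ) + 1) ^ (-ν) :=
            mul_le_mul_of_nonneg_right (min_le_left _ _) (by positivity)
        _ ≤ _ := by
            rw [one_mul, ht]; push_cast
            rw [← add_assoc, ← sub_div]; exact h2
    refine (Finset.sum_le_sum h1).trans ?_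
    rw [Finset.sum_range_sub']
    have h3 : 0 ≤ t n := by positivity
    have h4 : t 0 = (J : ℝ) ^ (-(ν - 1)) * (1 / (ν - 1)) := by rw [ht]; simp; ring
    linarith
  have hlog : (J : ℝ) ^ (-(ν - 1)) ≤ 2 ^ (ν - 1) * |Real.log d| ^ (-(ν - 1)) := by
    have hneg : Real.log d < 0 := Real.log_neg hd (by linarith)
    have h1 : |Real.log d| ≤ 2 * J := by
      rw [abs_of_neg hneg]
      have h2 := Real.log_lt_log (by positivity) hJ1
      rw [Real.log_pow, one_div, Real.log_inv] at h2
      have h3 := Real.log_two_lt_d9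
      push_cast at h2
      nlinarith
    have h4 : (2 * (J : ℝ)) ^ (-(ν - 1)) ≤ |Real.log d| ^ (-(ν - 1)) :=
      Real.rpow_le_rpow_of_nonpos (abs_pos.2 hneg.ne) h1 (by linarith)
    rw [Real.mul_rpow (by norm_num) (by positivity), Real.rpow_neg (by norm_num),
      inv_mul_le_iff₀ (by positivity)] at h4
    exact h4
  calc ∑ j ∈ Finset.range n, b j ≤ ∑ j ∈ Finset.range (J + n), b j :=
        Finset.sum_le_sum_of_subset_of_nonneg (Finset.range_mono (Nat.le_add_left n J))
          fun _ _ _ => hb0 _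
    _ = ∑ j ∈ Finset.range J, b j + ∑ i ∈ Finset.range n, b (J + i) := Finset.sum_range_add b J n
    _ ≤ (J : ℝ) ^ (-(ν - 1)) * (S + 1 / (ν - 1)) := by rw [mul_add]; exact add_le_add hlow hhigh
    _ ≤ (2 ^ (ν - 1) * |Real.log d| ^ (-(ν - 1))) * (S + 1 / (ν - 1)) := by gcongr
    _ = _ := by ring

/-! ### The solution operator for compactly supported data on the plane -/

/-- Compactly supported data on `ℂ` with modulus of continuity `M * logModulus ν`: the normalized
sum of the potentials at all dyadic scales `ε = 2R · 2⁻ʲ` solves the `∂̄`-equation on the disc of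
radius `R`, and its gradient loses one power of the logarithm. -/
theorem exists_dbar_solution_of_logModulus {ν R : ℝ} (hν : 1 < ν) (hR : 0 < R) :
    ∃ C : ℝ, 0 ≤ C ∧ ∀ (F : ℂ → ℂ) (M : ℝ), 0 ≤ M →
      (∀ x y, ‖F x - F y‖ ≤ M * logModulus ν ‖x - y‖) → (∀ x, R ≤ ‖x‖ → F x = 0) →
      ∃ (u : ℂ → ℂ) (u' : ℂ → ℂ →L[ℝ] ℂ), (∀ z, HasFDerivAt u (u' z) z) ∧ Continuous u' ∧
        (∀ z, ‖u z‖ ≤ C * M) ∧ (∀ z, ‖u' z‖ ≤ C * M) ∧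
        (∀ z w, 0 < ‖z - w‖ → ‖z - w‖ ≤ 1 / 2 →
          ‖u' z - u' w‖ ≤ C * M * |Real.log ‖z - w‖| ^ (-(ν - 1))) ∧
        ∀ z, ‖z‖ ≤ R → dbarCoeff (u' z) = F z := by
  have hν0 : 0 < ν := by linarith
  obtain ⟨B, hB0, hB⟩ := exists_bound_integral_smul_fderiv
  obtain ⟨B', hB'0, hB'⟩ := exists_bound_integral_mul
  obtain ⟨C₁, hC₁, hω⟩ := exists_logModulus_dyadic_le hν0 (show 0 < 6 * R by positivity)
  obtain ⟨C₂, hC₂, hsum⟩ := exists_sum_min_le hν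
  set c := ∫ w, radialBump w with hc
  have hc0 : 0 < c := integral_radialBump_pos
  set s : ℕ → ℝ := fun j => ((j : ℝ) + 1) ^ (-ν) with hs
  have hss : Summable s := summable_add_one_rpow_neg hν
  have hs0 : ∀ j, 0 ≤ s j := fun j => by positivity
  have hT0 : 0 ≤ ∑' j, s j := tsum_nonneg hs0
  -- The constant in `min 2 (d / ε) ≤ L * min 1 (d * 2 ^ j)` for `ε = 2 * R * (1 / 2) ^ j`.
  set L := 2 + 1 / (2 * R) with hL
  have hL0 : 0 < L := by positivity
  refine ⟨c⁻¹ * (4 * R * ν ^ (-ν) * B' + B * C₁ * ∑' j, s j + B * C₁ * L * C₂), by positivity,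
    fun F M hM hF hF0 => ?_⟩
  have hFc : Continuous F := continuous_of_logModulus hν0 hF
  have hFb : ∀ x, ‖F x‖ ≤ M * ν ^ (-ν) := fun x => by
    have h := hF x (R : ℂ)
    rw [hF0 R (by rw [Complex.norm_real]; exact le_abs_self R), sub_zero] at h
    exact h.trans (by gcongr; exact logModulus_le hν0 _)
  set ε : ℕ → ℝ := fun j => 2 * R * (1 / 2) ^ j with hε
  have hε0 : ∀ j, 0 < ε j := fun j => by positivity
  set v : ℕ → ℂ → ℂ := fun j => scalePotential F (ε j) with hv
  set A : ℕ → ℂ → ℂ →L[ℝ] ℂ := fun j => scaleGradient F (ε j) with hA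
  -- On balls of radius `3` the rescaled function `F (ε j • ·)` oscillates by at most `M C₁ s j`.
  have hosc : ∀ j, ∀ x y : ℂ, ‖x - y‖ ≤ 3 → ‖F (ε j • x) - F (ε j • y)‖ ≤ M * C₁ * s j := by
    intro j x y hxy
    refine (hF _ _).trans ?_
    rw [mul_assoc]
    refine mul_le_mul_of_nonneg_left (le_trans (logModulus_mono hν0 ?_) (hω j)) hM
    rw [← smul_sub, norm_smul, Real.norm_eq_abs, abs_of_pos (hε0 j)]
    calc ε j * ‖x - y‖ ≤ ε j * 3 := by gcongr
      _ = _ := by rw [hε]; ring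
  have hB1 : ∀ j z, ‖A j z‖ ≤ B * (M * C₁ * s j) := fun j z =>
    (hB _ _ (by fun_prop) (hosc j)).1 _
  have hB2 : ∀ j z w, ‖A j z - A j w‖ ≤ B * (M * C₁ * s j) * (‖z - w‖ / ε j) := fun j z w => by
    have h := (hB _ _ (by fun_prop) (hosc j)).2 ((ε j)⁻¹ • z) ((ε j)⁻¹ • w)
    rw [← smul_sub, norm_smul, Real.norm_eq_abs, abs_of_pos (inv_pos.2 (hε0 j)),
      ← div_eq_inv_mul] at h
    exact h
  have hB3 : ∀ j z w, ‖A j z - A j w‖ ≤ M * (B * C₁ * L) * (min 1 (‖z - w‖ * 2 ^ j) * s j) := by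
    intro j z w
    have hpos : 0 ≤ B * (M * C₁ * s j) := by have := hs0 j; positivity
    have h1 : ‖A j z - A j w‖ ≤ B * (M * C₁ * s j) * 2 :=
      (norm_sub_le _ _).trans (by linarith [hB1 j z, hB1 j w])
    have h2 : ‖z - w‖ / ε j = 1 / (2 * R) * (‖z - w‖ * 2 ^ j) := by
      rw [hε]; field_simp
      rw [mul_assoc, ← mul_pow]; norm_num
    have hR' : 0 < 1 / (2 * R) := by positivity
    have h3 : ‖A j z - A j w‖ ≤ B * (M * C₁ * s j) * (L * min 1 (‖z - w‖ * 2 ^ j)) := by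
      rcases min_cases (1 : ℝ) (‖z - w‖ * 2 ^ j) with ⟨h, -⟩ | ⟨h, -⟩ <;> rw [h]
      · exact h1.trans (by gcongr; rw [hL]; linarith)
      · refine (hB2 j z w).trans ?_
        rw [h2]
        gcongr
        rw [hL]; linarith
    calc _ ≤ _ := h3
      _ = _ := by ring
  have hsA : Summable fun j => B * (M * C₁ * s j) := (hss.mul_left _).mul_left _
  have hAz : ∀ z, Summable fun j => A j z := fun z => Summable.of_norm_bounded hsA fun j => hB1 j z
  have hvb : ∀ j z, ‖v j z‖ ≤ 2 * R * (M * ν ^ (-ν) * B') * (1 / 2) ^ j := fun j z => by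
    have h := hB' (fun t => F (ε j • t)) _ (fun t => hFb _) ((ε j)⁻¹ • z)
    calc ‖v j z‖ ≤ ε j * (M * ν ^ (-ν) * B') := by
          simp only [hv]
          rw [scalePotential, norm_smul, Real.norm_eq_abs, abs_of_pos (hε0 j)]
          exact mul_le_mul_of_nonneg_left h (hε0 j).le
      _ = _ := by rw [hε]; ring
  have hsv : Summable fun j : ℕ => 2 * R * (M * ν ^ (-ν) * B') * (1 / 2 : ℝ) ^ j :=
    summable_geometric_two.mul_left _
  have hvz : ∀ z, Summable fun j => v j z := fun z => Summable.of_norm_bounded hsv fun j => hvb j z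
  have hderiv : ∀ z, HasFDerivAt (fun y => ∑' j, v j y) (∑' j, A j z) z :=
    hasFDerivAt_tsum hsA (fun j z => hasFDerivAt_scalePotential hFc (hε0 j) z) hB1 (hvz 0)
  have hAc : ∀ j, Continuous (A j) := fun j => by
    refine (LipschitzWith.of_dist_le_mul (K := Real.toNNReal (B * (M * C₁ * s j) / ε j))
      fun z w => ?_).continuous
    have h1 := hs0 j
    have h2 := hε0 j
    rw [dist_eq_norm, dist_eq_norm, Real.coe_toNNReal _ (by positivity)]
    exact (hB2 j z w).trans_eq (by ring)
  have hu'c : Continuous fun z => (c : ℂ)⁻¹ • ∑' j, A j z :=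
    (continuous_tsum hAc hsA hB1).const_smul (c : ℂ)⁻¹
  have hcinv : ‖((c : ℂ))⁻¹‖ = c⁻¹ := by
    rw [norm_inv, Complex.norm_real, Real.norm_eq_abs, abs_of_pos hc0]
  have e1 : 0 ≤ 4 * R * ν ^ (-ν) * B' := by positivity
  have e2 : 0 ≤ B * C₁ * ∑' j, s j := by positivity
  have e3 : 0 ≤ B * C₁ * L * C₂ := by positivity
  refine ⟨fun y => (c : ℂ)⁻¹ • ∑' j, v j y, fun z => (c : ℂ)⁻¹ • ∑' j, A j z,
    fun z => (hderiv z).const_smul (c : ℂ)⁻¹, hu'c,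
    fun z => ?_, fun z => ?_, fun z w hd0 hd => ?_, fun z hz => ?_⟩
  · have h := tsum_of_norm_bounded hsv.hasSum fun j => hvb j z
    rw [tsum_mul_left, tsum_geometric_two] at h
    rw [norm_smul, hcinv, mul_assoc]
    gcongr
    refine h.trans ?_
    have := mul_nonneg (add_nonneg e2 e3) hM
    linarith
  · have h := tsum_of_norm_bounded hsA.hasSum fun j => hB1 j z
    rw [tsum_mul_left, tsum_mul_left] at h
    rw [norm_smul, hcinv, mul_assoc]
    gcongr
    refine h.trans ?_
    have := mul_nonneg (add_nonneg e1 e3) hM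
    linarith
  · have hsub : (c : ℂ)⁻¹ • ∑' j, A j z - (c : ℂ)⁻¹ • ∑' j, A j w =
        (c : ℂ)⁻¹ • (∑' j, A j z - ∑' j, A j w) := (smul_sub _ _ _).symm
    beta_reduce
    rw [hsub, norm_smul, hcinv, ← (hAz z).tsum_sub (hAz w)]
    have hsm : Summable fun j => min 1 (‖z - w‖ * 2 ^ j) * s j :=
      Summable.of_nonneg_of_le (fun j => by have := hs0 j; positivity)
        (fun j => mul_le_of_le_one_left (hs0 j) (min_le_left _ _)) hss
    have h := tsum_of_norm_bounded (hsm.mul_left (M * (B * C₁ * L))).hasSum fun j => hB3 j z w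
    rw [tsum_mul_left] at h
    have h1 := Real.tsum_le_of_sum_range_le (fun j => by have := hs0 j; positivity)
      (hsum _ hd0 hd)
    set ℓ := |Real.log ‖z - w‖| ^ (-(ν - 1)) with hℓ
    have hℓ0 : 0 ≤ ℓ := by positivity
    rw [mul_assoc, mul_assoc]
    gcongr
    refine h.trans ((mul_le_mul_of_nonneg_left h1 (by positivity)).trans ?_)
    have := mul_nonneg (mul_nonneg (add_nonneg e1 e2) hM) hℓ0
    linarith
  · rw [dbarCoeff_smul]
    -- The partial sums telescope to averages of `F` at smaller and smaller scales.
    have h1 : Filter.Tendsto (fun n => ∑ j ∈ Finset.range n, dbarCoeff (A j z)) Filter.atTop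
        (nhds (dbarCoeff (∑' j, A j z))) :=
      ((hAz z).hasSum.mapL dbarCoeff).tendsto_sum_nat
    have h2 : ∀ n, ∑ j ∈ Finset.range n, dbarCoeff (A j z) = bumpMean F (ε n) z := fun n => by
      have h3 : ∀ j, dbarCoeff (A j z) =
          bumpMean F (ε (j + 1)) z - bumpMean F (ε j) z := fun j => by
        simp only [hA]
        rw [dbarCoeff_scaleGradient hFc (hε0 j)]
        congr 2
        rw [hε]; ring
      have h4 : ε 0 = 2 * R := by simp [hε]
      simp only [h3]
      rw [Finset.sum_range_sub (fun j => bumpMean F (ε j) z), h4, bumpMean_eq_zero hR hF0 hz,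
        sub_zero]
    have h5 : Filter.Tendsto ε Filter.atTop (nhds 0) := by
      have h6 := (tendsto_pow_atTop_nhds_zero_of_lt_one (by norm_num : (0 : ℝ) ≤ 1 / 2)
        (by norm_num)).const_mul (2 * R)
      rwa [mul_zero] at h6
    simp only [h2] at h1
    rw [tendsto_nhds_unique h1 ((tendsto_bumpMean hFc hFb z).comp h5), ← hc, mul_comm,
      mul_assoc, mul_inv_cancel₀ (by exact_mod_cast hc0.ne'), mul_one]

/-! ### Norms -/

lemma cNorm_zero (Ω : Set ℂ) (f : ℂ → ℂ) : cNorm 0 Ω f = ⨆ w ∈ Ω, ‖f w‖ₑ := by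
  simp [cNorm, D]

lemma logSeminorm_zero (ν : ℝ) (Ω : Set ℂ) (f : ℂ → ℂ) : logSeminorm 0 ν Ω f =
    ⨆ (w : ℂ) (h : ℂ) (_ : w ∈ Ω) (_ : w + h ∈ Ω),
      ‖f (w + h) - f w‖ₑ * ENNReal.ofReal (|Real.log ‖h‖| ^ ν) := by
  simp [logSeminorm, D]

lemma cNorm_one (Ω : Set ℂ) (u : ℂ → ℂ) : cNorm 1 Ω u =
    (⨆ w ∈ Ω, ‖u w‖ₑ) + ((⨆ w ∈ Ω, ‖dy u w‖ₑ) + ⨆ w ∈ Ω, ‖dx u w‖ₑ) := by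
  simp [cNorm, D, Finset.sum_range_succ, Finset.Nat.antidiagonal_succ]

lemma logSeminorm_one (ν : ℝ) (Ω : Set ℂ) (u : ℂ → ℂ) : logSeminorm 1 ν Ω u =
    (⨆ (w : ℂ) (h : ℂ) (_ : w ∈ Ω) (_ : w + h ∈ Ω),
      ‖dy u (w + h) - dy u w‖ₑ * ENNReal.ofReal (|Real.log ‖h‖| ^ ν)) +
    ⨆ (w : ℂ) (h : ℂ) (_ : w ∈ Ω) (_ : w + h ∈ Ω),
      ‖dx u (w + h) - dx u w‖ₑ * ENNReal.ofReal (|Real.log ‖h‖| ^ ν) := by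
  simp [logSeminorm, D, Finset.Nat.antidiagonal_succ]

lemma MemLog.norm_le {ν : ℝ} {Ω : Set ℂ} {f : ℂ → ℂ} (hf : MemLog 0 ν Ω f) {w : ℂ} (hw : w ∈ Ω) :
    ‖f w‖ ≤ (logNorm 0 ν Ω f).toReal := by
  have h : ‖f w‖ₑ ≤ logNorm 0 ν Ω f := by
    rw [logNorm, cNorm_zero]
    exact (le_iSup₂ (f := fun w (_ : w ∈ Ω) => ‖f w‖ₑ) w hw).trans le_self_add
  simpa using ENNReal.toReal_mono hf.2.ne h

lemma MemLog.norm_sub_mul_le {ν : ℝ} {Ω : Set ℂ} {f : ℂ → ℂ} (hf : MemLog 0 ν Ω f) {z w : ℂ}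
    (hz : z ∈ Ω) (hw : w ∈ Ω) :
    ‖f z - f w‖ * |Real.log ‖z - w‖| ^ ν ≤ (logNorm 0 ν Ω f).toReal := by
  have h : ‖f z - f w‖ₑ * ENNReal.ofReal (|Real.log ‖z - w‖| ^ ν) ≤ logNorm 0 ν Ω f := by
    rw [logNorm, logSeminorm_zero]
    refine le_trans ?_ le_add_self
    refine le_trans ?_ (le_iSup_of_le w (le_iSup_of_le (z - w) (le_iSup_of_le hw
      (le_iSup_of_le (by rwa [add_sub_cancel]) le_rfl))))
    rw [add_sub_cancel]
  have h' := ENNReal.toReal_mono hf.2.ne h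
  rwa [ENNReal.toReal_mul, toReal_enorm, ENNReal.toReal_ofReal (by positivity)] at h'

/-- A function of class `C^{Log^ν L}` on a set inside the disc of radius `R`, extended by zero
outside the disc of radius `R + 1`, extends to the plane with the same type of modulus. -/
lemma exists_extension_of_memLog {ν R : ℝ} (hν : 0 < ν) {Ω : Set ℂ} (hΩ : ∀ z ∈ Ω, ‖z‖ ≤ R)
    {f : ℂ → ℂ} (hf : MemLog 0 ν Ω f) :
    ∃ F : ℂ → ℂ, Set.EqOn f F Ω ∧ (∀ x, R + 1 ≤ ‖x‖ → F x = 0) ∧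
      ∀ x y, ‖F x - F y‖ ≤ 2 * (1 + 2 * ν ^ ν) * (logNorm 0 ν Ω f).toReal *
        logModulus ν ‖x - y‖ := by
  classical
  set N := (logNorm 0 ν Ω f).toReal with hN
  have hN0 : 0 ≤ N := ENNReal.toReal_nonneg
  set f₁ := Ω.indicator f with hf₁
  have hb : ∀ x, ‖f₁ x‖ ≤ N := fun x => by
    by_cases hx : x ∈ Ω
    · rw [hf₁, Set.indicator_of_mem hx]; exact hf.norm_le hx
    · rw [hf₁, Set.indicator_of_notMem hx, norm_zero]; exact hN0
  set S := Ω ∪ {x | R + 1 ≤ ‖x‖} with hS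
  have hout : ∀ x, R + 1 ≤ ‖x‖ → f₁ x = 0 := fun x hx =>
    Set.indicator_of_notMem (fun h => by linarith [hΩ x h]) _
  have hνν : ν ^ ν * ν ^ (-ν) = 1 := by rw [← Real.rpow_add hν]; simp
  have hp : 0 < ν ^ ν := by positivity
  have hmod : ∀ x ∈ S, ∀ y ∈ S,
      ‖f₁ x - f₁ y‖ ≤ (1 + 2 * ν ^ ν) * N * logModulus ν (dist x y) := by
    intro x hx y hy
    rw [dist_eq_norm]
    rcases eq_or_ne x y with rfl | hxy
    · simp [logModulus_zero]
    have hd : 0 < ‖x - y‖ := norm_sub_pos_iff.2 hxy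
    rcases le_or_gt ν (-Real.log ‖x - y‖) with hnear | hfar
    · -- Points at distance less than `1` lie in the same part of `S`.
      have hlt : ‖x - y‖ < 1 := by
        by_contra h
        linarith [Real.log_nonneg (not_lt.1 h)]
      have h1 := norm_sub_norm_le x y
      have h2 := norm_sub_norm_le y x
      rw [norm_sub_rev] at h2
      rw [logModulus_of_pos hd, max_eq_right hnear]
      have hl : 0 < -Real.log ‖x - y‖ := hν.trans_le hnear
      have hle : N * (-Real.log ‖x - y‖) ^ (-ν) ≤
          (1 + 2 * ν ^ ν) * N * (-Real.log ‖x - y‖) ^ (-ν) := by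
        gcongr
        exact le_mul_of_one_le_left hN0 (by linarith)
      refine le_trans ?_ hle
      rcases hx with hx | hx <;> rcases hy with hy | hy
      · rw [hf₁, Set.indicator_of_mem hx, Set.indicator_of_mem hy, Real.rpow_neg hl.le,
          ← div_eq_mul_inv, le_div_iff₀ (by positivity)]
        have := hf.norm_sub_mul_le hx hy
        rwa [abs_of_neg (by linarith)] at this
      · have hy' : R + 1 ≤ ‖y‖ := hy
        linarith [hΩ x hx]
      · have hx' : R + 1 ≤ ‖x‖ := hx
        linarith [hΩ y hy]
      · rw [hout x hx, hout y hy, sub_zero, norm_zero]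
        positivity
    · rw [logModulus_of_pos hd, max_eq_left hfar.le]
      have hq : 0 ≤ ν ^ (-ν) := by positivity
      calc ‖f₁ x - f₁ y‖ ≤ N + N := (norm_sub_le _ _).trans (add_le_add (hb x) (hb y))
        _ = 2 * N * (ν ^ ν * ν ^ (-ν)) := by rw [hνν]; ring
        _ ≤ 2 * N * (ν ^ ν * ν ^ (-ν)) + N * ν ^ (-ν) := le_add_of_nonneg_right (by positivity)
        _ = _ := by ring
  obtain ⟨F, hF, hF'⟩ := exists_extension_complex
    (ω := fun t => (1 + 2 * ν ^ ν) * N * logModulus ν t)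
    (fun s t hst => mul_le_mul_of_nonneg_left (logModulus_mono hν hst) (by positivity))
    (by simp [logModulus_zero])
    (fun s t hs ht => by
      rw [← mul_add]
      exact mul_le_mul_of_nonneg_left (logModulus_add_le hν hs ht) (by positivity)) hmod
  refine ⟨F, fun x hx => ?_, fun x hx => ?_, fun x y => ?_⟩
  · rw [← hF (Or.inl hx), hf₁, Set.indicator_of_mem hx]
  · rw [← hF (Or.inr hx), hout x hx]
  · refine (hF' x y).trans_eq ?_
    rw [dist_eq_norm]; ring

/-- Weighted differences over a bounded set: for `|h| ≤ 1/2` the modulus of continuity is used, and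
for `|h| > 1/2` the weight is bounded. -/
lemma norm_sub_mul_abs_log_le {p R K : ℝ} (hp : 0 < p) (hR : 1 ≤ R) (hK : 0 ≤ K) {g : ℂ → ℂ}
    (hg : ∀ z, ‖g z‖ ≤ K)
    (hg' : ∀ z w, 0 < ‖z - w‖ → ‖z - w‖ ≤ 1 / 2 →
      ‖g z - g w‖ ≤ K * |Real.log ‖z - w‖| ^ (-p)) {w h : ℂ}
    (hh : ‖h‖ ≤ 2 * R) :
    ‖g (w + h) - g w‖ * |Real.log ‖h‖| ^ p ≤ K * (1 + 2 * (2 * R) ^ p) := by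
  have h2 : 0 ≤ 2 * (2 * R) ^ p := by positivity
  rcases eq_or_ne h 0 with rfl | h0
  · simp only [add_zero, sub_self, norm_zero, zero_mul]; positivity
  have hpos : 0 < ‖h‖ := norm_pos_iff.2 h0
  rcases le_or_gt ‖h‖ (1 / 2) with hle | hgt
  · have h1 := hg' (w + h) w (by simpa using h0) (by simpa using hle)
    rw [add_sub_cancel_left] at h1
    have hl : 0 < |Real.log ‖h‖| := abs_pos.2 (Real.log_neg hpos (by linarith)).ne
    calc _ ≤ K * |Real.log ‖h‖| ^ (-p) * |Real.log ‖h‖| ^ p := by gcongr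
      _ = K * 1 := by rw [mul_assoc, ← Real.rpow_add hl]; simp
      _ ≤ _ := by gcongr; linarith
  · have hl : |Real.log ‖h‖| ≤ 2 * R := by
      rw [abs_le]
      constructor
      · have := Real.log_le_log (by norm_num) hgt.le
        rw [one_div, Real.log_inv] at this
        linarith [Real.log_two_lt_d9]
      · linarith [Real.log_le_sub_one_of_pos hpos]
    calc _ ≤ (K + K) * (2 * R) ^ p := by
          gcongr
          exact (norm_sub_le _ _).trans (add_le_add (hg _) (hg _))
      _ ≤ (K + K) * (2 * R) ^ p + K := le_add_of_nonneg_right hK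
      _ = _ := by ring

lemma enorm_le_ofReal {x : ℂ} {K : ℝ} (h : ‖x‖ ≤ K) : ‖x‖ₑ ≤ ENNReal.ofReal K := by
  rw [← ofReal_norm]; exact ENNReal.ofReal_le_ofReal h

end LogCont

open LogCont in
theorem mainTheorem1 (Ω : Set ℂ) (α : ℝ≥0) (hα : 0 < α)
    (hΩ : LogCont.IsBoundedC1HolderDomain α Ω) (ν : ℝ) (hν : 1 < ν) :
    ∃ C : ℝ≥0, ∀ f : ℂ → ℂ, LogCont.MemLog 0 ν Ω f →
      ∃ u : ℂ → ℂ,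
        LogCont.MemLog 1 (ν - 1) Ω u ∧
        (∀ z ∈ Ω, LogCont.dbar u z = f z • LogCont.dzbar) ∧
        LogCont.logNorm 1 (ν - 1) Ω u ≤ C * LogCont.logNorm 0 ν Ω f ∧
        LogCont.MemCClosure 1 Ω u ∧
        LogCont.cNorm 1 Ω u ≤ C * LogCont.logNorm 0 ν Ω f := by
  have hν0 : 0 < ν := by linarith
  have hp : 0 < ν - 1 := by linarith
  obtain ⟨R, hR1, hR⟩ := hΩ.isBounded.exists_pos_norm_le
  obtain ⟨C, hC0, hC⟩ := exists_dbar_solution_of_logModulus hν (show 0 < R + 1 by positivity)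
  set Q := 1 + 2 * (2 * (R + 1)) ^ (ν - 1) with hQ
  have hQ0 : 0 < Q := by positivity
  refine ⟨Real.toNNReal (C * (2 * (1 + 2 * ν ^ ν)) * (3 + 2 * Q)), fun f hf => ?_⟩
  obtain ⟨F, hfF, hF0, hFm⟩ := exists_extension_of_memLog hν0 hR hf
  set N := (logNorm 0 ν Ω f).toReal with hN
  have hN0 : 0 ≤ N := ENNReal.toReal_nonneg
  obtain ⟨u, u', hu, hu'c, hub, hu'b, hu'm, hdb⟩ :=
    hC F (2 * (1 + 2 * ν ^ ν) * N) (by positivity) hFm hF0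
  set K := C * (2 * (1 + 2 * ν ^ ν) * N) with hK
  have hK0 : 0 ≤ K := by positivity
  have hfd : fderiv ℝ u = u' := funext fun z => (hu z).fderiv
  have hu1 : ContDiff ℝ 1 u := contDiff_one_iff_fderiv.2
    ⟨fun z => (hu z).differentiableAt, by rwa [hfd]⟩
  have hdir : ∀ e : ℂ, ‖e‖ = 1 → ∀ w h : ℂ, w ∈ Ω → w + h ∈ Ω →
      ‖u' (w + h) e - u' w e‖ * |Real.log ‖h‖| ^ (ν - 1) ≤ K * Q := fun e he w h hw hwh => by
    refine norm_sub_mul_abs_log_le hp (by linarith) hK0 (g := fun z => u' z e)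
      (fun z => ((u' z).le_opNorm e).trans (by simpa [he] using hu'b z))
      (fun z w h0 h1 => ?_) ?_
    · rw [← sub_apply]
      exact ((u' z - u' w).le_opNorm e).trans (by simpa [he] using hu'm z w h0 h1)
    · have := norm_sub_le (w + h) w
      rw [add_sub_cancel_left] at this
      linarith [hR _ hw, hR _ hwh]
  have hsup : ∀ e : ℂ, ‖e‖ = 1 → (⨆ w ∈ Ω, ‖u' w e‖ₑ) ≤ ENNReal.ofReal K := fun e he =>
    iSup₂_le fun w _ => enorm_le_ofReal (((u' w).le_opNorm e).trans (by simpa [he] using hu'b w))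
  have hsemi : ∀ e : ℂ, ‖e‖ = 1 → (⨆ (w : ℂ) (h : ℂ) (_ : w ∈ Ω) (_ : w + h ∈ Ω),
      ‖u' (w + h) e - u' w e‖ₑ * ENNReal.ofReal (|Real.log ‖h‖| ^ (ν - 1))) ≤
        ENNReal.ofReal (K * Q) := fun e he =>
    iSup₂_le fun w h => iSup₂_le fun hw hwh => by
      rw [← ofReal_norm, ← ENNReal.ofReal_mul (norm_nonneg _)]
      exact ENNReal.ofReal_le_ofReal (hdir e he w h hw hwh)
  have hc : cNorm 1 Ω u ≤ ENNReal.ofReal (3 * K) := by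
    rw [cNorm_one]
    simp only [dx, dy, hfd]
    calc _ ≤ ENNReal.ofReal K + (ENNReal.ofReal K + ENNReal.ofReal K) :=
          add_le_add (iSup₂_le fun w _ => enorm_le_ofReal (hub w))
            (add_le_add (hsup _ Complex.norm_I) (hsup _ norm_one))
      _ = _ := by
          rw [← ENNReal.ofReal_add hK0 hK0, ← ENNReal.ofReal_add hK0 (by positivity)]
          congr 1; ring
  have hl : logNorm 1 (ν - 1) Ω u ≤ ENNReal.ofReal (K * (3 + 2 * Q)) := by
    rw [logNorm, logSeminorm_one]
    simp only [dx, dy, hfd]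
    calc _ ≤ ENNReal.ofReal (3 * K) + (ENNReal.ofReal (K * Q) + ENNReal.ofReal (K * Q)) :=
          add_le_add hc (add_le_add (hsemi _ Complex.norm_I) (hsemi _ norm_one))
      _ = _ := by
          rw [← ENNReal.ofReal_add (by positivity) (by positivity),
            ← ENNReal.ofReal_add (by positivity) (by positivity)]
          congr 1; ring
  have hlast : ENNReal.ofReal (K * (3 + 2 * Q)) =
      Real.toNNReal (C * (2 * (1 + 2 * ν ^ ν)) * (3 + 2 * Q)) * logNorm 0 ν Ω f := by
    rw [← ENNReal.ofReal_toReal hf.2.ne, ← hN]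
    change _ = ENNReal.ofReal _ * _
    rw [← ENNReal.ofReal_mul (by positivity), hK]
    congr 1; ring
  have hlog : logNorm 1 (ν - 1) Ω u ≤
      Real.toNNReal (C * (2 * (1 + 2 * ν ^ ν)) * (3 + 2 * Q)) * logNorm 0 ν Ω f :=
    hl.trans_eq hlast
  refine ⟨u, ⟨by exact_mod_cast hu1.contDiffOn, hl.trans_lt ENNReal.ofReal_lt_top⟩,
    fun z hz => ?_, hlog, ⟨by exact_mod_cast hu1.contDiffOn, fun γ hγ =>
      ⟨D γ u, ?_, fun _ _ => rfl⟩⟩,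
    le_self_add.trans hlog⟩
  · have h := hdb z ((hR z hz).trans (by linarith))
    rw [dbarCoeff_apply] at h
    rw [dbar, dx, dy, hfd, h, hfF hz]
  · refine Continuous.continuousOn ?_
    obtain ⟨a, b⟩ := γ
    have hab : (a = 0 ∧ b = 0) ∨ (a = 1 ∧ b = 0) ∨ (a = 0 ∧ b = 1) := by
      simp only at hγ; omega
    have hdc : ∀ e : ℂ, Continuous fun z => u' z e := fun e => hu'c.clm_apply continuous_const
    rcases hab with ⟨rfl, rfl⟩ | ⟨rfl, rfl⟩ | ⟨rfl, rfl⟩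
    · exact hu1.continuous
    · change Continuous (dx u)
      unfold dx
      rw [hfd]; exact hdc 1
    · change Continuous (dy u)
      unfold dy
      rw [hfd]; exact hdc Complex.I
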